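/- Write $\mathcal M_d$ for the complex $d\times d$ matrices. A linear map $L:\mathcal M_{a}\to\mathcal M_{b}$ is positive if it maps positive semidefinite matrices to positive semidefinite matrices, and completely positive if $\mathrm{id}_k\otimes L$ is positive for every $k\in\mathbb N$. Its Choi matrix is $C_L=(\mathrm{id}_a\otimes L)(\omega_a)$ with $\omega_a=\sum_{i,j=1}^a |i\rangle\langle j|\otimes|i\rangle\langle j|$, and $L^*$ denotes its adjoint for the inner product $\langle A,B\rangle=\mathrm{Tr}[A^\dagger B]$. For a non-zero positive map $P:\mathcal M_{d_A}\to\mathcal M_{d_B}$ put $$\mu(P)=\inf\left\{\frac{\mathrm{Tr}[C_PC_T]}{\mathrm{Tr}[(T^*\circ P)(\mathbb 1_{d_A})]}\ :\ T:\mathcal M_{d_A}\to\mathcal M_{d_B}\text{ completely positive},\ (T^*\circ P)(\mathbb 1_{d_A})\neq 0\right\}.$$ Let $\mathbb F$ be the flip operator on $\mathbb C^d\otimes\mathbb C^d$, $P_{\rm sym}=\frac12(\mathbb 1+\mathbb F)$, $P_{\rm asym}=\frac12(\mathbb 1-\mathbb F)$, and let the Werner map $W_p:\mathcal M_d\to\mathcal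 M_d$, for $d\ge 2$ and $p\in[0,1]$, be the linear map with Choi matrix $$C_{W_p}=p\,\frac{P_{\rm sym}}{\mathrm{Tr}\,P_{\rm sym}}+(1-p)\,\frac{P_{\rm asym}}{\mathrm{Tr}\,P_{\rm asym}}.$$ Let $\vartheta_d(X)=X^T$ and $\mathrm{Ad}_Y(X)=YXY^\dagger$. **Theorem (Symmetrization of positive maps).** Let $P:\mathcal M_{d_A}\to\mathcal M_{d_B}$ be positive but not completely positive (which forces $d_A\geq 2$). Then $0\le\frac12(1+\mu(P))$, and for every real $p$ with $$\tfrac12\bigl(1+\mu(P)\bigr)<p<\tfrac12$$ there exists a completely positive map $S:\mathcal M_{d_B}\to\mathcal M_{d_A}$ such that $$\int_{\mathcal U_{d_A}}\mathrm{Ad}_U\circ\vartheta_{d_A}\circ S\circ P\circ\mathrm{Ad}_{U^T}\,\mathrm dU=W_p,$$ where $\mathrm dU$ is the normalized Haar measure on the group $\mathcal U_{d_A}$ of unitary $d_A\times d_A$ matrices and $W_p:\mathcal M_{d_A}\to\mathcal M_{d_A}$ is the Werner map. -/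

import Mathlib

open MeasureTheory
open scoped ComplexOrder Matrix Kronecker

/-- The algebra of complex `d × d` matrices. -/
abbrev Mat (d : ℕ) : Type := Matrix (Fin d) (Fin d) ℂ

/-! ### Positive and completely positive maps -/

/-- `L` maps positive semidefinite matrices to positive semidefinite matrices. -/
def IsPositiveMap {a b : ℕ} (L : Mat a →ₗ[ℂ] Mat b) : Prop :=
  ∀ X : Mat a, X.PosSemidef → (L X).PosSemidef

/-- The map `id_k ⊗ L` on `M_k ⊗ M_a`, realised as matrices indexed by `Fin k × Fin a`: the map `L`
is applied to each of the `k × k` blocks. -/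
def idTensor (k : ℕ) {a b : ℕ} (L : Mat a →ₗ[ℂ] Mat b) :
    Matrix (Fin k × Fin a) (Fin k × Fin a) ℂ →ₗ[ℂ] Matrix (Fin k × Fin b) (Fin k × Fin b) ℂ where
  toFun X := Matrix.of fun x y => L (Matrix.of fun i j => X (x.1, i) (y.1, j)) x.2 y.2
  map_add' X Y := by
    ext x y
    exact congrFun (congrFun (L.map_add (Matrix.of fun i j => X (x.1, i) (y.1, j))
      (Matrix.of fun i j => Y (x.1, i) (y.1, j))) x.2) y.2
  map_smul' c X := by
    ext x y
    exact congrFun (congrFun (L.map_smul c (Matrix.of fun i j => X (x.1, i) (y.1, j))) x.2) y.2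

theorem idTensor_kronecker (k : ℕ) {a b : ℕ} (L : Mat a →ₗ[ℂ] Mat b) (A : Mat k) (X : Mat a) :
    idTensor k L (A ⊗ₖ X) = A ⊗ₖ L X := by
  ext x y
  exact congrFun (congrFun (L.map_smul (A x.1 y.1) X) x.2) y.2

/-- `id_k ⊗ L` is positive for every `k`. -/
def IsCompletelyPositive {a b : ℕ} (L : Mat a →ₗ[ℂ] Mat b) : Prop :=
  ∀ (k : ℕ) (X : Matrix (Fin k × Fin a) (Fin k × Fin a) ℂ),
    X.PosSemidef → (idTensor k L X).PosSemidef

/-! ### Choi matrices -/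

/-- The unnormalised maximally entangled vector `∑ᵢ eᵢ ⊗ eᵢ`. -/
def maxEntVec (d : ℕ) : Fin d × Fin d → ℂ := fun x => if x.1 = x.2 then 1 else 0

/-- The unnormalised maximally entangled state `|Ω⟩⟨Ω|`. -/
def maxEnt (d : ℕ) : Matrix (Fin d × Fin d) (Fin d × Fin d) ℂ :=
  Matrix.vecMulVec (maxEntVec d) (star (maxEntVec d))

/-- The Choi matrix `(id ⊗ L)(|Ω⟩⟨Ω|)`. -/
def choi {a b : ℕ} (L : Mat a →ₗ[ℂ] Mat b) : Matrix (Fin a × Fin b) (Fin a × Fin b) ℂ :=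
  idTensor a L (maxEnt a)

theorem choi_apply {a b : ℕ} (L : Mat a →ₗ[ℂ] Mat b) (x y : Fin a × Fin b) :
    choi L x y = L (Matrix.single x.1 y.1 1) x.2 y.2 := by
  have h : (Matrix.of fun i j => maxEnt a (x.1, i) (y.1, j)) = Matrix.single x.1 y.1 (1 : ℂ) := by
    ext i j
    by_cases h1 : x.1 = i <;> by_cases h2 : y.1 = j <;>
      simp [maxEnt, maxEntVec, Matrix.vecMulVec_apply, h1, h2]
  exact congrFun (congrFun (congrArg L h) x.2) y.2

/-- The linear map whose Choi matrix is `C`. -/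
def ofChoi {a b : ℕ} (C : Matrix (Fin a × Fin b) (Fin a × Fin b) ℂ) : Mat a →ₗ[ℂ] Mat b where
  toFun X := Matrix.of fun k l => ∑ i, ∑ j, X i j * C (i, k) (j, l)
  map_add' X Y := by
    ext k l
    simp [add_mul, Finset.sum_add_distrib]
  map_smul' c X := by
    ext k l
    simp [mul_assoc, Finset.mul_sum]

theorem choi_ofChoi {a b : ℕ} (C : Matrix (Fin a × Fin b) (Fin a × Fin b) ℂ) :
    choi (ofChoi C) = C := by
  ext x y
  rw [choi_apply]
  simp [ofChoi, Matrix.single_apply, ite_and]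

theorem choi_injective {a b : ℕ} :
    Function.Injective (choi : (Mat a →ₗ[ℂ] Mat b) → _) := by
  intro L M h
  refine Matrix.ext_linearMap ℂ fun i j => LinearMap.ext_ring ?_
  ext k l
  have := congrFun (congrFun h (i, k)) (j, l)
  simpa [choi_apply] using this

/-! ### The adjoint for the Hilbert-Schmidt inner product and the quantity `μ` -/

/-- The adjoint of `T` with respect to `⟨A, B⟩ = Tr (Aᴴ B)`, given by its matrix entries
`⟨Eᵢⱼ, T* Y⟩ = ⟨T Eᵢⱼ, Y⟩`. -/
def hsAdjoint {a b : ℕ} (T : Mat a →ₗ[ℂ] Mat b) : Mat b →ₗ[ℂ] Mat a where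
  toFun Y := Matrix.of fun i j => ((T (Matrix.single i j 1))ᴴ * Y).trace
  map_add' X Y := by
    ext i j
    simp [mul_add]
  map_smul' c X := by
    ext i j
    simp

theorem trace_hsAdjoint {a b : ℕ} (T : Mat a →ₗ[ℂ] Mat b) (X : Mat a) (Y : Mat b) :
    (Xᴴ * hsAdjoint T Y).trace = ((T X)ᴴ * Y).trace := by
  conv_rhs => rw [Matrix.matrix_eq_sum_single X]
  have h : ∀ i j, T (Matrix.single i j (X i j)) = X i j • T (Matrix.single i j 1) := by
    intro i j
    rw [← map_smul, Matrix.smul_single, smul_eq_mul, mul_one]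
  simp only [map_sum, h, Matrix.conjTranspose_sum, Matrix.conjTranspose_smul, Finset.sum_mul,
    Matrix.trace_sum, Matrix.smul_mul, Matrix.trace_smul, smul_eq_mul]
  rw [Finset.sum_comm]
  simp [Matrix.trace, Matrix.mul_apply, hsAdjoint]

/-- `μ(P) = inf { Tr[C_P C_T] / Tr[(T* ∘ P)(1)] | T completely positive, (T* ∘ P)(1) ≠ 0 }`.
For positive `P` all traces occurring here are real. -/
noncomputable def mu {a b : ℕ} (P : Mat a →ₗ[ℂ] Mat b) : ℝ :=
  sInf {r : ℝ | ∃ T : Mat a →ₗ[ℂ] Mat b, IsCompletelyPositive T ∧ (hsAdjoint T ∘ₗ P) 1 ≠ 0 ∧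
    r = (choi P * choi T).trace.re / ((hsAdjoint T ∘ₗ P) 1).trace.re}

/-! ### Werner states and Werner maps -/

/-- The flip operator `e_i ⊗ e_j ↦ e_j ⊗ e_i`. -/
def flipOp (d : ℕ) : Matrix (Fin d × Fin d) (Fin d × Fin d) ℂ :=
  Matrix.of fun x y => if x = y.swap then 1 else 0

/-- The projector onto the symmetric subspace. -/
noncomputable def projSym (d : ℕ) : Matrix (Fin d × Fin d) (Fin d × Fin d) ℂ :=
  (1 / 2 : ℂ) • (1 + flipOp d)

/-- The projector onto the antisymmetric subspace. -/
noncomputable def projAsym (d : ℕ) : Matrix (Fin d × Fin d) (Fin d × Fin d) ℂ :=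
  (1 / 2 : ℂ) • (1 - flipOp d)

/-- The Werner state `p P_sym / d_sym + (1 - p) P_asym / d_asym`, where `d_sym` and `d_asym` are the
traces of the two projectors. -/
noncomputable def wernerState (d : ℕ) (p : ℝ) : Matrix (Fin d × Fin d) (Fin d × Fin d) ℂ :=
  ((p : ℂ) / (projSym d).trace) • projSym d + ((1 - p : ℂ) / (projAsym d).trace) • projAsym d

/-- The Werner map, whose Choi matrix is the Werner state. -/
noncomputable def wernerMap (d : ℕ) (p : ℝ) : Mat d →ₗ[ℂ] Mat d := ofChoi (wernerState d p)

/-! ### Averages over the unitary group -/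

/-- The transposition map `X ↦ Xᵀ`. -/
def transposeMap (d : ℕ) : Mat d →ₗ[ℂ] Mat d := (Matrix.transposeLinearEquiv _ _ ℂ ℂ).toLinearMap

/-- The map `Ad_Y : X ↦ Y X Yᴴ`. -/
def Ad {a b : ℕ} (Y : Matrix (Fin b) (Fin a) ℂ) : Mat a →ₗ[ℂ] Mat b where
  toFun X := Y * X * Yᴴ
  map_add' X Z := by rw [Matrix.mul_add, Matrix.add_mul]
  map_smul' c X := by simp

/-- The group of unitary `d × d` matrices. -/
abbrev UGroup (d : ℕ) : Type := Matrix.unitaryGroup (Fin d) ℂ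

instance UGroup.instCompactSpace (d : ℕ) : CompactSpace (UGroup d) := by
  have hK : IsCompact (Set.univ.pi fun _ : Fin d => Set.univ.pi fun _ : Fin d =>
      Metric.closedBall (0 : ℂ) 1) :=
    isCompact_univ_pi fun _ => isCompact_univ_pi fun _ => isCompact_closedBall 0 1
  have hC : IsClosed (Matrix.unitaryGroup (Fin d) ℂ : Set (Mat d)) := isClosed_unitary
  refine isCompact_iff_compactSpace.mp (hK.of_isClosed_subset hC fun U hU i _ j _ => ?_)
  rw [mem_closedBall_zero_iff]
  exact entry_norm_bound_of_unitary hU i j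

noncomputable instance UGroup.instMeasurableSpace (d : ℕ) : MeasurableSpace (UGroup d) := borel _

instance UGroup.instBorelSpace (d : ℕ) : BorelSpace (UGroup d) := ⟨rfl⟩

/-- The Haar probability measure on the unitary group. -/
noncomputable def unitaryHaar (d : ℕ) : Measure (UGroup d) := Measure.haarMeasure ⊤

instance unitaryHaar.instIsProbabilityMeasure (d : ℕ) : IsProbabilityMeasure (unitaryHaar d) :=
  ⟨Measure.haarMeasure_self⟩

/-- The integral `∫ F(U) dU` of a family of linear maps against the Haar probability measure: the
linear map whose coefficients with respect to the matrix units are the integrals of the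
coefficients of `F(U)`. -/
noncomputable def haarIntegral (d : ℕ) (F : UGroup d → (Mat d →ₗ[ℂ] Mat d)) :
    Mat d →ₗ[ℂ] Mat d where
  toFun X := Matrix.of fun i j =>
    ∑ k, ∑ l, X k l * ∫ U, F U (Matrix.single k l 1) i j ∂(unitaryHaar d)
  map_add' X Y := by
    ext i j
    simp [add_mul, Finset.sum_add_distrib]
  map_smul' c X := by
    ext i j
    simp [mul_assoc, Finset.mul_sum]

theorem haarIntegral_apply (d : ℕ) (F : UGroup d → (Mat d →ₗ[ℂ] Mat d))
    (hF : ∀ X i j, Integrable (fun U => F U X i j) (unitaryHaar d))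
    (X : Mat d) (i j : Fin d) :
    haarIntegral d F X i j = ∫ U, F U X i j ∂(unitaryHaar d) := by
  have h : ∀ U, F U X i j = ∑ k, ∑ l, X k l * F U (Matrix.single k l 1) i j := by
    intro U
    conv_lhs => rw [Matrix.matrix_eq_sum_single X]
    have h : ∀ k l, F U (Matrix.single k l (X k l)) = X k l • F U (Matrix.single k l 1) := by
      intro k l
      rw [← map_smul, Matrix.smul_single, smul_eq_mul, mul_one]
    simp [map_sum, h, Matrix.sum_apply]
  have h1 : ∀ k l, Integrable (fun U => X k l * F U (Matrix.single k l 1) i j) (unitaryHaar d) :=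
    fun k l => (hF (Matrix.single k l 1) i j).const_mul _
  calc haarIntegral d F X i j
      = ∑ k, ∑ l, X k l * ∫ U, F U (Matrix.single k l 1) i j ∂(unitaryHaar d) := rfl
    _ = ∑ k, ∑ l, ∫ U, X k l * F U (Matrix.single k l 1) i j ∂(unitaryHaar d) :=
        Finset.sum_congr rfl fun k _ => Finset.sum_congr rfl fun l _ =>
          (integral_const_mul _ _).symm
    _ = ∑ k, ∫ U, ∑ l, X k l * F U (Matrix.single k l 1) i j ∂(unitaryHaar d) :=
        Finset.sum_congr rfl fun k _ => (integral_finsetSum _ fun l _ => h1 k l).symm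
    _ = ∫ U, ∑ k, ∑ l, X k l * F U (Matrix.single k l 1) i j ∂(unitaryHaar d) :=
        (integral_finsetSum _ fun k _ => integrable_finsetSum _ fun l _ => h1 k l).symm
    _ = ∫ U, F U X i j ∂(unitaryHaar d) := integral_congr_ae (.of_forall fun U => (h U).symm)

/-- Every family `U ↦ Ad_U ∘ L ∘ Ad_{Uᵀ}` has integrable coefficients. -/
theorem integrable_twirl (d : ℕ) (L : Mat d →ₗ[ℂ] Mat d) (X : Mat d) (i j : Fin d) :
    Integrable (fun U : UGroup d => (Ad (U : Mat d) ∘ₗ L ∘ₗ Ad (U : Mat d)ᵀ) X i j)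
      (unitaryHaar d) := by
  have hU : Continuous fun U : UGroup d => (U : Mat d) := continuous_subtype_val
  have hV := hU.matrix_transpose
  have h := L.continuous_of_finiteDimensional.comp
    ((hV.mul (continuous_const (y := X))).mul hV.matrix_conjTranspose)
  have h2 := ((hU.mul h).mul hU.matrix_conjTranspose).matrix_elem i j
  exact h2.integrable_of_hasCompactSupport (isClosed_tsupport _).isCompact

/-! ### Kraus decompositions -/

/-! Averaging `Ad_U ∘ L ∘ Ad_{Uᵀ}` conjugates `C_L` by `U ⊗ U` and integrates. By Haar invariance
the result is fixed by all such conjugations, hence of the form `a • 1 + b • F`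
(`IsTwirlInvariant.exists_coeff`). The twirl preserves `Tr C_L` and `Tr[F C_L]`, and for `d ≥ 2`
these two numbers determine `a` and `b`; the Werner map corresponds to the values `1` and `2p - 1`
(`twirl_eq_wernerMap`).

For `L = ϑ ∘ T* ∘ P` the two numbers are the denominator and the numerator of the quotient defining
`μ(P)`. So it suffices to find a completely positive `T` with denominator `1` and quotient `2p - 1`.
As `μ(P) < 2p - 1 < 0`, some `T₀` has a smaller quotient; a rank-one `T₁` has a nonnegative one. A
positive combination of their adjoints meets the target exactly.

The bound `-1 ≤ μ(P)` holds because `ϑ ∘ T* ∘ P` is positive and `e ⊗ e` is a symmetric product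
vector: positivity makes the symmetric eigenvalue `a + b` nonnegative. -/

theorem isCompletelyPositive_Ad {a b : ℕ} (Y : Matrix (Fin b) (Fin a) ℂ) :
    IsCompletelyPositive (Ad Y) := by
  intro k X hX
  have h : idTensor k (Ad Y) X =
      ((1 : Mat k) ⊗ₖ Y) * X * ((1 : Mat k) ⊗ₖ Y)ᴴ := by
    ext ⟨x, i⟩ ⟨y, j⟩
    simp [idTensor, Ad, Matrix.mul_apply, Matrix.one_apply, Fintype.sum_prod_type,
      apply_ite (starRingEnd ℂ)]
  rw [h]
  exact hX.mul_mul_conjTranspose_same _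

theorem IsCompletelyPositive.add {a b : ℕ} {S T : Mat a →ₗ[ℂ] Mat b}
    (hS : IsCompletelyPositive S) (hT : IsCompletelyPositive T) :
    IsCompletelyPositive (S + T) := fun k X hX =>
  (hS k X hX).add (hT k X hX)

theorem IsCompletelyPositive.smul {a b : ℕ} {T : Mat a →ₗ[ℂ] Mat b}
    (hT : IsCompletelyPositive T) {c : ℂ} (hc : 0 ≤ c) :
    IsCompletelyPositive (c • T) := fun k X hX =>
  (hT k X hX).smul hc

theorem isCompletelyPositive_sum {ι : Type*} {a b : ℕ} (s : Finset ι)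
    {T : ι → (Mat a →ₗ[ℂ] Mat b)} (h : ∀ i, IsCompletelyPositive (T i)) :
    IsCompletelyPositive (∑ i ∈ s, T i) := by
  classical
  induction s using Finset.induction_on with
  | empty => exact fun k X _ => Matrix.PosSemidef.zero
  | insert i s hi ih =>
    rw [Finset.sum_insert hi]
    exact (h i).add ih

theorem posSemidef_choi {a b : ℕ} {T : Mat a →ₗ[ℂ] Mat b} (hT : IsCompletelyPositive T) :
    (choi T).PosSemidef :=
  hT a _ (Matrix.posSemidef_vecMulVec_self_star _)

theorem ofChoi_choi {a b : ℕ} (T : Mat a →ₗ[ℂ] Mat b) : ofChoi (choi T) = T :=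
  choi_injective (choi_ofChoi _)

/-- A completely positive map has a Kraus decomposition. -/
theorem IsCompletelyPositive.exists_kraus {a b : ℕ} {T : Mat a →ₗ[ℂ] Mat b}
    (hT : IsCompletelyPositive T) :
    ∃ K : Fin a × Fin b → Matrix (Fin b) (Fin a) ℂ, T = ∑ m, Ad (K m) := by
  obtain ⟨B, hB⟩ : ∃ B : Matrix (Fin a × Fin b) (Fin a × Fin b) ℂ, choi T = Bᴴ * B := by
    open scoped MatrixOrder Matrix.Norms.L2Operator in
    exact CStarAlgebra.nonneg_iff_eq_star_mul_self.mp (posSemidef_choi hT).nonneg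
  -- Each row of `B`, conjugated and reshaped, is one Kraus operator.
  refine ⟨fun m => Matrix.of fun k i => star (B m (i, k)), ?_⟩
  rw [← ofChoi_choi T, hB]
  ext X k l
  simp only [ofChoi, LinearMap.coe_mk, AddHom.coe_mk, Matrix.of_apply, LinearMap.coe_sum,
    Finset.sum_apply, Matrix.sum_apply, Ad, Matrix.mul_apply, Matrix.conjTranspose_apply,
    star_star, Finset.sum_mul, Finset.mul_sum]
  rw [Finset.sum_comm_cycle]
  refine Finset.sum_congr rfl fun m _ => ?_
  rw [Finset.sum_comm]
  exact Finset.sum_congr rfl fun _ _ => Finset.sum_congr rfl fun _ _ => by ring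

theorem hsAdjoint_sum {ι : Type*} {a b : ℕ} (s : Finset ι) (T : ι → (Mat a →ₗ[ℂ] Mat b)) :
    hsAdjoint (∑ i ∈ s, T i) = ∑ i ∈ s, hsAdjoint (T i) := by
  ext Y i j
  simp [hsAdjoint, Matrix.conjTranspose_sum, Finset.sum_mul, Matrix.trace_sum, Matrix.sum_apply]

theorem hsAdjoint_Ad {a b : ℕ} (Y : Matrix (Fin b) (Fin a) ℂ) : hsAdjoint (Ad Y) = Ad Yᴴ := by
  ext X i j
  simp only [hsAdjoint, Ad, LinearMap.coe_mk, AddHom.coe_mk, Matrix.of_apply,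
    Matrix.conjTranspose_mul, Matrix.conjTranspose_conjTranspose, Matrix.conjTranspose_single,
    star_one]
  rw [Matrix.trace_mul_comm, ← Matrix.mul_assoc, ← Matrix.mul_assoc, Matrix.trace_mul_comm,
    ← Matrix.mul_assoc, ← Matrix.mul_assoc, Matrix.trace_mul_single]
  simp

theorem IsCompletelyPositive.hsAdjoint {a b : ℕ} {T : Mat a →ₗ[ℂ] Mat b}
    (hT : IsCompletelyPositive T) : IsCompletelyPositive (hsAdjoint T) := by
  obtain ⟨K, rfl⟩ := hT.exists_kraus
  rw [hsAdjoint_sum]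
  refine isCompletelyPositive_sum _ fun m => ?_
  rw [hsAdjoint_Ad]
  exact isCompletelyPositive_Ad _

theorem isPositiveMap_Ad {a b : ℕ} (Y : Matrix (Fin b) (Fin a) ℂ) : IsPositiveMap (Ad Y) :=
  fun _ hX => hX.mul_mul_conjTranspose_same _

theorem IsPositiveMap.comp {a b c : ℕ} {L : Mat b →ₗ[ℂ] Mat c} {M : Mat a →ₗ[ℂ] Mat b}
    (hL : IsPositiveMap L) (hM : IsPositiveMap M) : IsPositiveMap (L ∘ₗ M) :=
  fun X hX => hL _ (hM X hX)

theorem isPositiveMap_transposeMap (d : ℕ) : IsPositiveMap (transposeMap d) :=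
  fun _ hX => hX.transpose

theorem IsCompletelyPositive.isPositiveMap {a b : ℕ} {T : Mat a →ₗ[ℂ] Mat b}
    (hT : IsCompletelyPositive T) : IsPositiveMap T := by
  obtain ⟨K, rfl⟩ := hT.exists_kraus
  intro X hX
  rw [LinearMap.sum_apply]
  exact Matrix.posSemidef_sum _ fun m _ => isPositiveMap_Ad _ X hX

/-! ### The numerator and the denominator in the definition of `μ` -/

/-- Since `C_T` is Hermitian, its entries can be conjugated into those of `T*`; the trace becomes
the pairing of the Choi matrix of `T* ∘ P` with `|Ω⟩⟨Ω|`. -/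
theorem trace_choi_mul_choi {a b : ℕ} (P : Mat a →ₗ[ℂ] Mat b) {T : Mat a →ₗ[ℂ] Mat b}
    (hT : IsCompletelyPositive T) :
    (choi P * choi T).trace =
      ∑ i, ∑ j, (hsAdjoint T ∘ₗ P) (Matrix.single i j 1) i j := by
  have hH : ∀ x y, choi T y x = star (T (Matrix.single x.1 y.1 1) x.2 y.2) := fun x y => by
    rw [← choi_apply]
    exact ((posSemidef_choi hT).isHermitian.apply y x).symm
  simp only [Matrix.trace, Matrix.diag_apply, Matrix.mul_apply, hH, choi_apply,
    Fintype.sum_prod_type, LinearMap.comp_apply, hsAdjoint, LinearMap.coe_mk, AddHom.coe_mk,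
    Matrix.of_apply, Matrix.conjTranspose_apply]
  refine Finset.sum_congr rfl fun i _ => ?_
  rw [Finset.sum_comm]
  refine Finset.sum_congr rfl fun j _ => ?_
  rw [Finset.sum_comm]
  exact Finset.sum_congr rfl fun _ _ => Finset.sum_congr rfl fun _ _ => mul_comm _ _

/-! ### The Werner twirl -/

/-- The average of `Ad_U ∘ L ∘ Ad_{Uᵀ}` over the unitary group. -/
noncomputable def twirl {d : ℕ} (L : Mat d →ₗ[ℂ] Mat d) : Mat d →ₗ[ℂ] Mat d :=
  haarIntegral d fun U => Ad (U : Mat d) ∘ₗ L ∘ₗ Ad (U : Mat d)ᵀ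

theorem twirl_apply {d : ℕ} (L : Mat d →ₗ[ℂ] Mat d) (X : Mat d) (i j : Fin d) :
    twirl L X i j =
      ∫ U, (Ad (U : Mat d) ∘ₗ L ∘ₗ Ad (U : Mat d)ᵀ) X i j ∂(unitaryHaar d) :=
  haarIntegral_apply d _ (fun X i j => integrable_twirl d L X i j) X i j

theorem Ad_comp_Ad {a b c : ℕ} (Y : Matrix (Fin c) (Fin b) ℂ) (Z : Matrix (Fin b) (Fin a) ℂ) :
    Ad Y ∘ₗ Ad Z = Ad (Y * Z) :=
  LinearMap.ext fun X => by simp [Ad, Matrix.mul_assoc]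

theorem Ad_apply_apply {a b : ℕ} (Y : Matrix (Fin b) (Fin a) ℂ) (X : Mat a) (i j : Fin b) :
    Ad Y X i j = ∑ l, ∑ k, Y i k * star (Y j l) * X k l := by
  simp only [Ad, LinearMap.coe_mk, AddHom.coe_mk, Matrix.mul_apply, Matrix.conjTranspose_apply,
    Finset.sum_mul]
  exact Finset.sum_congr rfl fun _ _ => Finset.sum_congr rfl fun _ _ => by ring

instance unitaryHaar.instIsMulLeftInvariant (d : ℕ) : (unitaryHaar d).IsMulLeftInvariant :=
  inferInstanceAs (Measure.haarMeasure ⊤).IsMulLeftInvariant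

/-- The outer factors turn `U` into `VU` on both sides, as `(VU)ᵀ = UᵀVᵀ`; left invariance of Haar
measure absorbs the shift. -/
theorem Ad_twirl_Ad {d : ℕ} (L : Mat d →ₗ[ℂ] Mat d) (V : UGroup d) :
    Ad (V : Mat d) ∘ₗ twirl L ∘ₗ Ad (V : Mat d)ᵀ = twirl L := by
  ext1 X
  ext i j
  have hint := fun k l => integrable_twirl d L (Ad (V : Mat d)ᵀ X) k l
  rw [LinearMap.comp_apply, LinearMap.comp_apply, Ad_apply_apply]
  simp only [twirl_apply, ← integral_const_mul]
  simp_rw [← integral_finsetSum _ fun k _ => (hint k _).const_mul _]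
  rw [← integral_finsetSum _ fun l _ => integrable_finsetSum _ fun k _ => (hint k l).const_mul _]
  have := integral_mul_left_eq_self (μ := unitaryHaar d)
    (fun U : UGroup d => (Ad (U : Mat d) ∘ₗ L ∘ₗ Ad (U : Mat d)ᵀ) X i j) V
  rw [← this]
  refine integral_congr_ae (.of_forall fun U => ?_)
  simp only
  rw [← Ad_apply_apply]
  simp only [LinearMap.comp_apply, Submonoid.coe_mul, Matrix.transpose_mul, ← Ad_comp_Ad]

/-- The coefficients of `L` in the matrix units. -/
def coeff {d : ℕ} (L : Mat d →ₗ[ℂ] Mat d) (i j k l : Fin d) : ℂ := L (Matrix.single i j 1) k l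

/-- This is conjugation of the Choi matrix by `V ⊗ V`, in coordinates. -/
theorem coeff_Ad_comp_Ad {d : ℕ} (L : Mat d →ₗ[ℂ] Mat d) (V : Mat d) (i j k l : Fin d) :
    coeff (Ad V ∘ₗ L ∘ₗ Ad Vᵀ) i j k l = ∑ a, ∑ b, ∑ c, ∑ e,
      V i a * star (V j b) * V k c * star (V l e) * coeff L a b c e := by
  have h : Ad Vᵀ (Matrix.single i j 1) =
      ∑ a, ∑ b, (V i a * star (V j b)) • Matrix.single a b (1 : ℂ) := by
    conv_lhs => rw [Matrix.matrix_eq_sum_single (Ad Vᵀ (Matrix.single i j 1))]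
    refine Finset.sum_congr rfl fun a _ => Finset.sum_congr rfl fun b _ => ?_
    rw [Matrix.smul_single, smul_eq_mul, mul_one, Ad_apply_apply]
    simp [Matrix.single_apply, ite_and]
  simp only [coeff, LinearMap.comp_apply, h, map_sum, map_smul, Ad_apply_apply,
    Matrix.sum_apply, Matrix.smul_apply, smul_eq_mul]
  simp only [Finset.mul_sum]
  rw [Finset.sum_comm_cycle]
  refine Finset.sum_congr rfl fun a _ => ?_
  rw [Finset.sum_comm_cycle]
  refine Finset.sum_congr rfl fun b _ => ?_
  rw [Finset.sum_comm]
  exact Finset.sum_congr rfl fun c _ => Finset.sum_congr rfl fun e _ => by ring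

theorem sum_unitary_mul_star {d : ℕ} (V : UGroup d) (a b : Fin d) :
    ∑ i, (V : Mat d) i a * star ((V : Mat d) i b) = if a = b then 1 else 0 := by
  have h := congrFun (congrFun (Unitary.coe_star_mul_self V) b) a
  simp only [Matrix.mul_apply, Matrix.star_apply, Matrix.one_apply] at h
  simp only [eq_comm (a := a)]
  rw [← h]
  exact Finset.sum_congr rfl fun _ _ => mul_comm _ _

theorem sum_sum_sum_comm {ι : Type*} [Fintype ι] (f : ι → ι → ι → ι → ι → ι → ℂ) :
    ∑ i, ∑ k, ∑ a, ∑ b, ∑ c, ∑ e, f i k a b c e =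
      ∑ a, ∑ b, ∑ c, ∑ e, ∑ i, ∑ k, f i k a b c e := by
  rw [Finset.sum_comm_cycle]
  refine Finset.sum_congr rfl fun a _ => ?_
  rw [Finset.sum_comm_cycle]
  refine Finset.sum_congr rfl fun b _ => ?_
  rw [Finset.sum_comm_cycle]
  refine Finset.sum_congr rfl fun c _ => ?_
  rw [Finset.sum_comm_cycle]

theorem sum_coeff_diag_Ad {d : ℕ} (L : Mat d →ₗ[ℂ] Mat d) (V : UGroup d) :
    ∑ i, ∑ k, coeff (Ad (V : Mat d) ∘ₗ L ∘ₗ Ad (V : Mat d)ᵀ) i i k k =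
      ∑ i, ∑ k, coeff L i i k k := by
  simp only [coeff_Ad_comp_Ad]
  rw [sum_sum_sum_comm]
  calc _ = ∑ a, ∑ b, ∑ c, ∑ e, (∑ i, (V : Mat d) i a * star ((V : Mat d) i b)) *
        (∑ k, (V : Mat d) k c * star ((V : Mat d) k e)) * coeff L a b c e := by
        simp only [Finset.sum_mul_sum]
        simp only [Finset.sum_mul, mul_assoc]
    _ = _ := by
        simp only [sum_unitary_mul_star]
        simp

/-- The sum is `Tr[F C_L]`, and `F` commutes with `V ⊗ V`. -/
theorem sum_coeff_flip_Ad {d : ℕ} (L : Mat d →ₗ[ℂ] Mat d) (V : UGroup d) :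
    ∑ i, ∑ k, coeff (Ad (V : Mat d) ∘ₗ L ∘ₗ Ad (V : Mat d)ᵀ) i k k i =
      ∑ i, ∑ k, coeff L i k k i := by
  simp only [coeff_Ad_comp_Ad]
  rw [sum_sum_sum_comm]
  calc _ = ∑ a, ∑ b, ∑ c, ∑ e, (∑ i, (V : Mat d) i a * star ((V : Mat d) i e)) *
        (∑ k, (V : Mat d) k c * star ((V : Mat d) k b)) * coeff L a b c e := by
        simp only [Finset.sum_mul_sum]
        simp only [Finset.sum_mul]
        iterate 6 refine Finset.sum_congr rfl fun _ _ => ?_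
        ring
    _ = _ := by
        simp only [sum_unitary_mul_star]
        simp

theorem integrable_coeff_twirl {d : ℕ} (L : Mat d →ₗ[ℂ] Mat d) (i j k l : Fin d) :
    Integrable (fun U : UGroup d => coeff (Ad (U : Mat d) ∘ₗ L ∘ₗ Ad (U : Mat d)ᵀ) i j k l)
      (unitaryHaar d) :=
  integrable_twirl d L _ k l

theorem coeff_twirl {d : ℕ} (L : Mat d →ₗ[ℂ] Mat d) (i j k l : Fin d) :
    coeff (twirl L) i j k l =
      ∫ U, coeff (Ad (U : Mat d) ∘ₗ L ∘ₗ Ad (U : Mat d)ᵀ) i j k l ∂(unitaryHaar d) :=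
  twirl_apply L _ k l

theorem sum_coeff_diag_twirl {d : ℕ} (L : Mat d →ₗ[ℂ] Mat d) :
    ∑ i, ∑ k, coeff (twirl L) i i k k = ∑ i, ∑ k, coeff L i i k k := by
  simp only [coeff_twirl]
  simp_rw [← integral_finsetSum _ fun k _ => integrable_coeff_twirl L _ _ k k]
  rw [← integral_finsetSum _ fun i _ => integrable_finsetSum _ fun k _ =>
    integrable_coeff_twirl L i i k k]
  simp only [sum_coeff_diag_Ad, integral_const, probReal_univ, one_smul]

theorem sum_coeff_flip_twirl {d : ℕ} (L : Mat d →ₗ[ℂ] Mat d) :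
    ∑ i, ∑ k, coeff (twirl L) i k k i = ∑ i, ∑ k, coeff L i k k i := by
  simp only [coeff_twirl]
  simp_rw [← integral_finsetSum _ fun k _ => integrable_coeff_twirl L _ k k _]
  rw [← integral_finsetSum _ fun i _ => integrable_finsetSum _ fun k _ =>
    integrable_coeff_twirl L i k k i]
  simp only [sum_coeff_flip_Ad, integral_const, probReal_univ, one_smul]

/-! ### Maps commuting with the twirl -/

/-- `L` is fixed by every `L ↦ Ad_V ∘ L ∘ Ad_{Vᵀ}`. -/
def IsTwirlInvariant {d : ℕ} (L : Mat d →ₗ[ℂ] Mat d) : Prop :=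
  ∀ V ∈ Matrix.unitaryGroup (Fin d) ℂ, Ad V ∘ₗ L ∘ₗ Ad Vᵀ = L

theorem isTwirlInvariant_twirl {d : ℕ} (L : Mat d →ₗ[ℂ] Mat d) : IsTwirlInvariant (twirl L) :=
  fun V hV => Ad_twirl_Ad L ⟨V, hV⟩

namespace IsTwirlInvariant

variable {d : ℕ} {L : Mat d →ₗ[ℂ] Mat d}

theorem coeff_eq (hL : IsTwirlInvariant L) {V : Mat d}
    (hV : V ∈ Matrix.unitaryGroup (Fin d) ℂ) (i j k l : Fin d) :
    coeff L i j k l = ∑ a, ∑ b, ∑ c, ∑ e,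
      V i a * star (V j b) * V k c * star (V l e) * coeff L a b c e := by
  rw [← coeff_Ad_comp_Ad, hL V hV]

theorem coeff_eq_diagonal (hL : IsTwirlInvariant L) {v : Fin d → ℂ}
    (hv : ∀ i, v i * star (v i) = 1) (i j k l : Fin d) :
    coeff L i j k l = v i * star (v j) * v k * star (v l) * coeff L i j k l := by
  have hV : Matrix.diagonal v ∈ Matrix.unitaryGroup (Fin d) ℂ := by
    rw [Matrix.mem_unitaryGroup_iff, Matrix.star_eq_conjTranspose, Matrix.diagonal_conjTranspose,
      Matrix.diagonal_mul_diagonal, ← Matrix.diagonal_one]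
    exact congrArg _ (funext hv)
  conv_lhs => rw [hL.coeff_eq hV]
  simp [Matrix.diagonal_apply, apply_ite (starRingEnd ℂ), ite_mul]

/-- A diagonal unitary multiplies the coefficient by a product of phases, which must be `1` unless
the coefficient vanishes. The phase `I` at one index suffices; `-1` would not, because `i = k` can
give its square. -/
theorem coeff_eq_zero (hL : IsTwirlInvariant L) {i j k l : Fin d}
    (h : ¬ ((i = j ∧ k = l) ∨ (i = l ∧ k = j))) : coeff L i j k l = 0 := by
  have hI : (Complex.I : ℂ) ≠ 1 := fun h => by simpa using congrArg Complex.re h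
  have hI' : (-1 : ℂ) ≠ 1 := by norm_num
  by_contra hne
  have key : ∀ x : Fin d, _ = (1 : ℂ) := fun x => (mul_eq_right₀ hne).mp
    (hL.coeff_eq_diagonal (v := fun y => if y = x then Complex.I else 1)
      (fun y => by by_cases hy : y = x <;> simp [hy]) i j k l).symm
  by_cases hij : i = j
  · subst hij
    have hkl : l ≠ k := fun h' => h (.inl ⟨rfl, h'.symm⟩)
    have hk := key k
    by_cases hik : i = k <;> simp [hik, hkl, hI] at hk
  by_cases hil : i = l
  · subst hil
    have hkj : j ≠ k := fun h' => h (.inr ⟨rfl, h'.symm⟩)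
    have hk := key k
    by_cases hik : i = k <;> simp [hik, hkj, hI] at hk
  have hi := key i
  by_cases hik : k = i <;> simp [hik, Ne.symm hij, Ne.symm hil, hI, hI'] at hi

theorem coeff_perm (hL : IsTwirlInvariant L) (σ : Equiv.Perm (Fin d)) (i j k l : Fin d) :
    coeff L (σ i) (σ j) (σ k) (σ l) = coeff L i j k l := by
  have hV : (Matrix.of fun i a => if i = σ a then (1 : ℂ) else 0) ∈
      Matrix.unitaryGroup (Fin d) ℂ := by
    rw [Matrix.mem_unitaryGroup_iff']
    ext a b
    simp [Matrix.mul_apply, Matrix.one_apply, apply_ite (starRingEnd ℂ), eq_comm]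
  rw [hL.coeff_eq hV]
  simp [apply_ite (starRingEnd ℂ), ite_mul]

theorem coeff_same (hL : IsTwirlInvariant L) {i j : Fin d} (hij : i ≠ j) :
    coeff L i i i i = coeff L i i j j + coeff L i j j i := by
  -- `V` is the Householder reflection along `eᵢ - 2eⱼ`. It mixes the two basis vectors with
  -- rational entries: row `i` is `(3/5, 4/5)`.
  set w : Fin d → ℂ := Pi.single i 1 - 2 • Pi.single j 1 with hw
  set V : Mat d := 1 - (2 / 5 : ℂ) • Matrix.vecMulVec w w with hVdef
  have hwi : w i = 1 := by simp [hw, hij]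
  have hwj : w j = -2 := by simp [hw, hij.symm]
  have hwk : ∀ k, k ≠ i → k ≠ j → w k = 0 := fun k hi hj => by simp [hw, hi, hj]
  have hww : w ⬝ᵥ w = 5 := by
    rw [dotProduct, Fintype.sum_eq_add i j hij fun k hk => by rw [hwk k hk.1 hk.2, zero_mul],
      hwi, hwj]
    norm_num
  have hstar : star V = V := by
    ext a b
    have hs : ∀ k, (starRingEnd ℂ) (w k) = w k := fun k => by
      by_cases hi : k = i
      · simp [hi, hwi]
      by_cases hj : k = j
      · rw [hj, hwj, map_neg, Complex.conj_ofNat]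
      simp [hwk k hi hj]
    simp [hVdef, Matrix.vecMulVec_apply, Matrix.one_apply, hs,
      apply_ite (starRingEnd ℂ), eq_comm, mul_comm]
  have hV : V ∈ Matrix.unitaryGroup (Fin d) ℂ := by
    rw [Matrix.mem_unitaryGroup_iff, hstar]
    have : Matrix.vecMulVec w w * Matrix.vecMulVec w w = (5 : ℂ) • Matrix.vecMulVec w w := by
      rw [Matrix.vecMulVec_mul_vecMulVec, hww]
      ext; simp [Matrix.vecMulVec_apply, mul_left_comm]
    simp only [hVdef, sub_mul, mul_sub, one_mul, mul_one, smul_mul_smul_comm, this, smul_smul]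
    module
  have hVi : V i i = 3 / 5 := by
    simp [hVdef, Matrix.vecMulVec_apply, hwi]; norm_num
  have hVj : V i j = 4 / 5 := by
    simp [hVdef, Matrix.vecMulVec_apply, hwi, hwj, hij]; norm_num
  have hVk : ∀ k, k ≠ i → k ≠ j → V i k = 0 := fun k hi hj => by
    simp [hVdef, Matrix.vecMulVec_apply, hwk k hi hj, hi.symm]
  have hsum : ∀ f : Fin d → ℂ, (∀ k, k ≠ i → k ≠ j → f k = 0) → ∑ k, f k = f i + f j :=
    fun f hf => Fintype.sum_eq_add i j hij fun k hk => hf k hk.1 hk.2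
  have hrow : ∀ g : Fin d → ℂ, ∑ a, V i a * g a = 3 / 5 * g i + 4 / 5 * g j := fun g => by
    rw [hsum _ fun k hi hj => by rw [hVk k hi hj, zero_mul], hVi, hVj]
  have hrow' : ∀ g : Fin d → ℂ, ∑ a, star (V i a) * g a = 3 / 5 * g i + 4 / 5 * g j :=
    fun g => by
      rw [hsum _ fun k hi hj => by rw [hVk k hi hj, star_zero, zero_mul], hVi, hVj]
      simp
  have h := hL.coeff_eq hV i i i i
  simp only [mul_assoc, ← Finset.mul_sum] at h
  simp only [hrow, hrow'] at h
  have hji := hij.symm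
  have hs : ∀ a b c e, coeff L (Equiv.swap i j a) (Equiv.swap i j b) (Equiv.swap i j c)
      (Equiv.swap i j e) = coeff L a b c e := hL.coeff_perm (Equiv.swap i j)
  have e1 := hs i i i i
  have e2 := hs i i j j
  have e3 := hs i j j i
  simp only [Equiv.swap_apply_left, Equiv.swap_apply_right] at e1 e2 e3
  have z : ∀ a b c e, ¬ ((a = b ∧ c = e) ∨ (a = e ∧ c = b)) → coeff L a b c e = 0 :=
    fun a b c e => hL.coeff_eq_zero
  rw [e1, e2, e3, z i i i j (by tauto), z i i j i (by tauto), z i j i i (by tauto),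
    z j i i i (by tauto), z i j i j (by tauto), z j i j i (by tauto), z i j j j (by tauto),
    z j i j j (by tauto), z j j i j (by tauto), z j j j i (by tauto)] at h
  -- With `C` the left side of the goal and `x`, `y` the summands on its right, `h` reads `C = (81 +
  -- 256)/625 * C + 2 * 144/625 * (x + y)`.
  linear_combination (625 / 288 : ℂ) * h

/-- A map fixed by the twirl has Choi matrix `a • 1 + b • F`. -/
theorem exists_coeff (hL : IsTwirlInvariant L) : ∃ a b : ℂ, ∀ i j k l, coeff L i j k l =
    a * (if i = j ∧ k = l then 1 else 0) + b * (if i = l ∧ k = j then 1 else 0) := by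
  rcases isEmpty_or_nonempty (Fin d) with hd | ⟨⟨o⟩⟩
  · exact ⟨0, 0, fun i => hd.elim i⟩
  rcases subsingleton_or_nontrivial (Fin d) with hd | hd
  -- For `d = 1` the identity and the flip coincide, so only `a + b` matters.
  · refine ⟨coeff L o o o o, 0, fun i j k l => ?_⟩
    simp [Subsingleton.elim i o, Subsingleton.elim j o, Subsingleton.elim k o,
      Subsingleton.elim l o]
  obtain ⟨x, y, hxy⟩ := exists_pair_ne (Fin d)
  have hp : ∀ i k, i ≠ k → ∃ σ : Equiv.Perm (Fin d), σ x = i ∧ σ y = k := fun i k hik =>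
    MulAction.is_two_pretransitive_iff.mp (Equiv.Perm.isMultiplyPretransitive (Fin d) 2) hxy hik
  have h1 : ∀ i k, i ≠ k → coeff L i i k k = coeff L x x y y := fun i k hik => by
    obtain ⟨σ, rfl, rfl⟩ := hp i k hik
    exact hL.coeff_perm σ x x y y
  have h2 : ∀ i k, i ≠ k → coeff L i k k i = coeff L x y y x := fun i k hik => by
    obtain ⟨σ, rfl, rfl⟩ := hp i k hik
    exact hL.coeff_perm σ x y y x
  refine ⟨coeff L x x y y, coeff L x y y x, fun i j k l => ?_⟩
  by_cases hik : i = j ∧ k = l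
  · obtain ⟨rfl, rfl⟩ := hik
    by_cases h : i = k
    · subst h
      obtain ⟨m, hm⟩ := exists_ne i
      simp [hL.coeff_same hm.symm, h1 i m hm.symm, h2 i m hm.symm]
    · simp [h1 i k h, h]
  by_cases hil : i = l ∧ k = j
  · obtain ⟨rfl, rfl⟩ := hil
    have h : i ≠ k := fun h => hik ⟨h, h.symm⟩
    simp [h2 i k h, h]
  rw [hL.coeff_eq_zero (by tauto), if_neg hik, if_neg hil]
  simp

end IsTwirlInvariant

/-! ### From the invariant form to Werner maps -/

theorem sum_sum_coeff_diag {d : ℕ} (L : Mat d →ₗ[ℂ] Mat d) :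
    ∑ i, ∑ k, coeff L i i k k = (L 1).trace := by
  have h : (1 : Mat d) = ∑ i, Matrix.single i i 1 := by
    rw [← Matrix.diagonal_one, ← Matrix.sum_single_eq_diagonal]
  rw [h, map_sum, Matrix.trace_sum]
  rfl

/-- The coefficients of the twirl of `L` are determined by `Tr L(1)` and `Tr[F C_L]`. -/
theorem exists_coeff_twirl {d : ℕ} (L : Mat d →ₗ[ℂ] Mat d) : ∃ a b : ℂ,
    (∀ i j k l, coeff (twirl L) i j k l =
      a * (if i = j ∧ k = l then 1 else 0) + b * (if i = l ∧ k = j then 1 else 0)) ∧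
    a * d ^ 2 + b * d = (L 1).trace ∧ a * d + b * d ^ 2 = ∑ i, ∑ k, coeff L i k k i := by
  obtain ⟨a, b, h⟩ := (isTwirlInvariant_twirl L).exists_coeff
  refine ⟨a, b, h, ?_, ?_⟩
  · rw [← sum_sum_coeff_diag, ← sum_coeff_diag_twirl]
    simp only [h, Finset.sum_add_distrib, ← Finset.mul_sum]
    simp [ite_and, sq]
  · rw [← sum_coeff_flip_twirl]
    simp only [h, Finset.sum_add_distrib, ← Finset.mul_sum]
    simp [ite_and, sq]

theorem flipOp_apply {d : ℕ} (x y : Fin d × Fin d) :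
    flipOp d x y = if x.1 = y.2 ∧ x.2 = y.1 then 1 else 0 := by
  simp [flipOp, Prod.ext_iff]

theorem trace_flipOp (d : ℕ) : (flipOp d).trace = d := by
  simp [Matrix.trace, flipOp_apply, Fintype.sum_prod_type, ite_and]

theorem trace_projSym (d : ℕ) : (projSym d).trace = (d ^ 2 + d) / 2 := by
  simp [projSym, Matrix.trace_add, trace_flipOp, sq]
  ring

theorem trace_projAsym (d : ℕ) : (projAsym d).trace = (d ^ 2 - d) / 2 := by
  simp [projAsym, Matrix.trace_sub, trace_flipOp, sq]
  ring

/-- The twirl of a map `L` with `Tr L(1) = 1` and `Tr[F C_L] = 2p - 1` is the Werner map. -/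
theorem twirl_eq_wernerMap {d : ℕ} (hd : 2 ≤ d) (L : Mat d →ₗ[ℂ] Mat d) (p : ℝ)
    (h1 : (L 1).trace = 1) (h2 : ∑ i, ∑ k, coeff L i k k i = 2 * p - 1) :
    twirl L = wernerMap d p := by
  obtain ⟨a, b, h, ht, hf⟩ := exists_coeff_twirl L
  rw [h1] at ht
  rw [h2] at hf
  have hd2 : (2 : ℝ) ≤ d := by exact_mod_cast hd
  have hs : (d ^ 2 + d : ℂ) ≠ 0 := by
    have : (d ^ 2 + d : ℝ) ≠ 0 := by positivity
    exact_mod_cast this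
  have ha : (d ^ 2 - d : ℂ) ≠ 0 := by
    have : (d ^ 2 - d : ℝ) ≠ 0 := by nlinarith
    exact_mod_cast this
  -- `a + b` and `a - b` are the eigenvalues of `a • 1 + b • F` on the symmetric and antisymmetric
  -- subspaces.
  have hab : a + b = 2 * p / (d ^ 2 + d) := by
    rw [eq_div_iff hs]; linear_combination ht + hf
  have hab' : a - b = 2 * (1 - p) / (d ^ 2 - d) := by
    rw [eq_div_iff ha]; linear_combination ht - hf
  apply choi_injective
  rw [wernerMap, choi_ofChoi]
  ext ⟨i, k⟩ ⟨j, l⟩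
  rw [choi_apply]
  change coeff (twirl L) i j k l = _
  simp only [h, wernerState, trace_projSym, trace_projAsym]
  simp only [projSym, projAsym, Matrix.add_apply, Matrix.smul_apply, Matrix.sub_apply, flipOp_apply, Matrix.one_apply,
    smul_eq_mul, Prod.mk.injEq]
  have e1 : (p : ℂ) / ((d ^ 2 + d) / 2) = a + b := by rw [hab]; field_simp
  have e2 : (1 - p : ℂ) / ((d ^ 2 - d) / 2) = a - b := by rw [hab']; field_simp
  rw [e1, e2]
  ring

theorem posSemidef_single {d : ℕ} (i : Fin d) : (Matrix.single i i (1 : ℂ)).PosSemidef := by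
  rw [← Matrix.diagonal_single]
  refine .diagonal fun j => ?_
  by_cases hj : j = i <;> simp [hj]

theorem IsPositiveMap.coeff_twirl_nonneg {d : ℕ} {L : Mat d →ₗ[ℂ] Mat d} (hL : IsPositiveMap L)
    (i k : Fin d) : 0 ≤ coeff (twirl L) i i k k := by
  rw [coeff_twirl]
  refine integral_nonneg fun U => ?_
  exact ((isPositiveMap_Ad _).comp (hL.comp (isPositiveMap_Ad _)) _
    (posSemidef_single i)).diag_nonneg

/-- For a positive map `L` the projection of `C_L` onto the symmetric subspace has nonnegative
trace. -/
theorem IsPositiveMap.trace_add_flip_nonneg {d : ℕ} {L : Mat d →ₗ[ℂ] Mat d}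
    (hL : IsPositiveMap L) : 0 ≤ (L 1).trace + ∑ i, ∑ k, coeff L i k k i := by
  obtain ⟨a, b, h, ht, hf⟩ := exists_coeff_twirl L
  rcases isEmpty_or_nonempty (Fin d) with hd | ⟨⟨o⟩⟩
  · simp [Matrix.trace]
  -- The product vector `e_o ⊗ e_o` is symmetric, so this coefficient is `a + b`.
  have h0 := hL.coeff_twirl_nonneg o o
  rw [h] at h0
  simp only [and_self, if_true, mul_one] at h0
  have : (0 : ℂ) ≤ (d ^ 2 + d : ℝ) := by exact_mod_cast (by positivity)
  calc (0 : ℂ) ≤ (a + b) * (d ^ 2 + d : ℝ) := mul_nonneg h0 this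
    _ = _ := by rw [← ht, ← hf]; push_cast; ring

/-! ### Bounds for the quotients in the definition of `μ` -/

section

variable {a b : ℕ} {P : Mat a →ₗ[ℂ] Mat b} {T : Mat a →ₗ[ℂ] Mat b}

theorem trace_transposeMap_comp {d : ℕ} (M : Mat d →ₗ[ℂ] Mat d) :
    ((transposeMap d ∘ₗ M) 1).trace = (M 1).trace :=
  Matrix.trace_transpose _

/-- Transposing the output exchanges `|Ω⟩⟨Ω|` and the flip, which turns the numerator into a
quantity the twirl preserves. -/
theorem sum_coeff_transposeMap_comp (hT : IsCompletelyPositive T) :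
    ∑ i, ∑ k, coeff (transposeMap a ∘ₗ hsAdjoint T ∘ₗ P) i k k i =
      (choi P * choi T).trace :=
  (trace_choi_mul_choi P hT).symm

theorem trace_hsAdjoint_comp_nonneg (hP : IsPositiveMap P) (hT : IsCompletelyPositive T) :
    0 ≤ ((hsAdjoint T ∘ₗ P) 1).trace :=
  (hT.hsAdjoint.isPositiveMap.comp hP _ .one).trace_nonneg

theorem trace_hsAdjoint_comp_re_pos (hP : IsPositiveMap P) (hT : IsCompletelyPositive T)
    (h : (hsAdjoint T ∘ₗ P) 1 ≠ 0) : 0 < ((hsAdjoint T ∘ₗ P) 1).trace.re := by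
  have hpsd := hT.hsAdjoint.isPositiveMap.comp hP _ .one
  have h0 : 0 < ((hsAdjoint T ∘ₗ P) 1).trace :=
    lt_of_le_of_ne hpsd.trace_nonneg fun h' => h (hpsd.trace_eq_zero_iff.mp h'.symm)
  exact (Complex.pos_iff.mp h0).1

theorem trace_hsAdjoint_comp_im (hP : IsPositiveMap P) (hT : IsCompletelyPositive T) :
    ((hsAdjoint T ∘ₗ P) 1).trace.im = 0 :=
  (Complex.nonneg_iff.mp (trace_hsAdjoint_comp_nonneg hP hT)).2.symm

theorem trace_add_trace_choi_nonneg (hP : IsPositiveMap P) (hT : IsCompletelyPositive T) :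
    0 ≤ ((hsAdjoint T ∘ₗ P) 1).trace + (choi P * choi T).trace := by
  have h := ((isPositiveMap_transposeMap a).comp
    (hT.hsAdjoint.isPositiveMap.comp hP)).trace_add_flip_nonneg
  rwa [sum_coeff_transposeMap_comp hT, trace_transposeMap_comp] at h

/-- In the order on `ℂ`, being nonnegative includes being real; so the previous inequality also
makes the numerator real. -/
theorem trace_choi_im (hP : IsPositiveMap P) (hT : IsCompletelyPositive T) :
    (choi P * choi T).trace.im = 0 := by
  have h := (Complex.nonneg_iff.mp (trace_add_trace_choi_nonneg hP hT)).2
  rw [Complex.add_im, trace_hsAdjoint_comp_im hP hT, zero_add] at h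
  exact h.symm

theorem neg_one_le_mu (hP : IsPositiveMap P) : -1 ≤ mu P := by
  unfold mu
  rcases Set.eq_empty_or_nonempty {r : ℝ | ∃ T : Mat a →ₗ[ℂ] Mat b, IsCompletelyPositive T ∧
    (hsAdjoint T ∘ₗ P) 1 ≠ 0 ∧
    r = (choi P * choi T).trace.re / ((hsAdjoint T ∘ₗ P) 1).trace.re} with h | h
  -- An infimum over the empty set is `0` by convention.
  · rw [h, Real.sInf_empty]; norm_num
  refine le_csInf h ?_
  rintro _ ⟨T, hT, hne, rfl⟩
  rw [le_div_iff₀ (trace_hsAdjoint_comp_re_pos hP hT hne)]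
  have := (Complex.nonneg_iff.mp (trace_add_trace_choi_nonneg hP hT)).1
  rw [Complex.add_re] at this
  linarith

theorem exists_lt_of_mu_lt {q : ℝ} (hq : mu P < q) (hq0 : q < 0) :
    ∃ T : Mat a →ₗ[ℂ] Mat b, IsCompletelyPositive T ∧ (hsAdjoint T ∘ₗ P) 1 ≠ 0 ∧
      (choi P * choi T).trace.re / ((hsAdjoint T ∘ₗ P) 1).trace.re < q := by
  unfold mu at hq
  rcases Set.eq_empty_or_nonempty {r : ℝ | ∃ T : Mat a →ₗ[ℂ] Mat b, IsCompletelyPositive T ∧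
    (hsAdjoint T ∘ₗ P) 1 ≠ 0 ∧
    r = (choi P * choi T).trace.re / ((hsAdjoint T ∘ₗ P) 1).trace.re} with h | h
  -- `q < 0` rules out the default value `0`.
  · rw [h, Real.sInf_empty] at hq
    exact absurd hq hq0.not_gt
  obtain ⟨_, ⟨T, hT, hne, rfl⟩, hlt⟩ := exists_lt_of_csInf_lt h hq
  exact ⟨T, hT, hne, hlt⟩

/-- There is a completely positive map with nonnegative quotient. -/
theorem exists_trace_choi_nonneg (hP : IsPositiveMap P) (h1 : P 1 ≠ 0) (o : Fin a) :
    ∃ T : Mat a →ₗ[ℂ] Mat b, IsCompletelyPositive T ∧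
      0 < ((hsAdjoint T ∘ₗ P) 1).trace.re ∧ 0 ≤ (choi P * choi T).trace.re := by
  have hpsd := hP _ .one
  obtain ⟨k, hk⟩ : ∃ k, P 1 k k ≠ 0 := by
    by_contra! hk
    exact h1 (hpsd.trace_eq_zero_iff.mp (Finset.sum_eq_zero fun k _ => hk k))
  -- For `T = Ad` of a matrix unit, the numerator is `P(E_oo)_kk` and the denominator `P(1)_kk`.
  have hY : ∀ X : Mat a, (hsAdjoint (Ad (Matrix.single k o (1 : ℂ))) ∘ₗ P) X =
      Matrix.single o o (P X k k) := fun X => by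
    rw [hsAdjoint_Ad]
    simp [Ad, Matrix.single_mul_mul_single]
  have hT := isCompletelyPositive_Ad (Matrix.single k o (1 : ℂ))
  refine ⟨_, hT, ?_, ?_⟩
  · refine trace_hsAdjoint_comp_re_pos hP hT fun h => hk ?_
    rw [hY] at h
    simpa using congrFun (congrFun h o) o
  · rw [trace_choi_mul_choi P hT]
    simp only [hY, Matrix.single_apply]
    have := (Complex.nonneg_iff.mp ((hP _ (posSemidef_single o)).diag_nonneg (i := k))).1
    simpa [ite_and] using this

end

/-! ### The symmetrization theorem -/

theorem mainTheorem3 (dA dB : ℕ) (P : Mat dA →ₗ[ℂ] Mat dB)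
    (hP : IsPositiveMap P) (hPcp : ¬ IsCompletelyPositive P) :
    0 ≤ (1 + mu P) / 2 ∧
    ∀ p : ℝ, (1 + mu P) / 2 < p → p < 1 / 2 →
      ∃ S : Mat dB →ₗ[ℂ] Mat dA, IsCompletelyPositive S ∧
        haarIntegral dA (fun U =>
          Ad (U : Mat dA) ∘ₗ transposeMap dA ∘ₗ S ∘ₗ P ∘ₗ Ad (U : Mat dA)ᵀ) = wernerMap dA p := by
  refine ⟨by linarith [neg_one_le_mu hP], fun p hp hp' => ?_⟩
  obtain ⟨T₀, hT₀, hne, hlt⟩ := exists_lt_of_mu_lt (P := P) (q := 2 * p - 1) (by linarith)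
    (by linarith)
  have hD₀ := trace_hsAdjoint_comp_re_pos hP hT₀ hne
  rw [div_lt_iff₀ hD₀] at hlt
  -- In dimension at most one, numerator and denominator agree, so the quotient would be `1`, not
  -- negative.
  have hd : 2 ≤ dA := by
    by_contra! hd
    have : Subsingleton (Fin dA) := Fin.subsingleton_iff_le_one.mpr (by omega)
    have heq : (choi P * choi T₀).trace = ((hsAdjoint T₀ ∘ₗ P) 1).trace := by
      rw [trace_choi_mul_choi P hT₀, ← sum_sum_coeff_diag]
      refine Finset.sum_congr rfl fun i _ => Finset.sum_congr rfl fun j _ => ?_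
      rw [Subsingleton.elim j i]
      rfl
    rw [heq] at hlt
    nlinarith
  have hP1 : P 1 ≠ 0 := fun h => hne (by rw [LinearMap.comp_apply, h, map_zero])
  obtain ⟨T₁, hT₁, hD₁, hN₁⟩ := exists_trace_choi_nonneg hP hP1 ⟨0, by omega⟩
  set D₀ := ((hsAdjoint T₀ ∘ₗ P) 1).trace.re with hD₀def
  set D₁ := ((hsAdjoint T₁ ∘ₗ P) 1).trace.re with hD₁def
  set N₀ := (choi P * choi T₀).trace.re with hN₀def
  set N₁ := (choi P * choi T₁).trace.re with hN₁def
  -- The weights solve `s N₀ + t N₁ = (2p - 1)(s D₀ + t D₁)`; dividing by `c` normalises the trace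
  -- to `1`.
  set s := N₁ - (2 * p - 1) * D₁ with hs
  set t := (2 * p - 1) * D₀ - N₀ with ht
  have hs0 : 0 < s := by nlinarith
  have ht0 : 0 < t := by linarith
  set c := s * D₀ + t * D₁ with hc
  have hc0 : 0 < c := by positivity
  have eD₀ : ((hsAdjoint T₀ ∘ₗ P) 1).trace = (D₀ : ℂ) :=
    Complex.ext rfl (trace_hsAdjoint_comp_im hP hT₀)
  have eD₁ : ((hsAdjoint T₁ ∘ₗ P) 1).trace = (D₁ : ℂ) :=
    Complex.ext rfl (trace_hsAdjoint_comp_im hP hT₁)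
  have eN₀ : (choi P * choi T₀).trace = (N₀ : ℂ) := Complex.ext rfl (trace_choi_im hP hT₀)
  have eN₁ : (choi P * choi T₁).trace = (N₁ : ℂ) := Complex.ext rfl (trace_choi_im hP hT₁)
  have hsc : (0 : ℂ) ≤ ((s / c : ℝ) : ℂ) := by exact_mod_cast (by positivity)
  have htc : (0 : ℂ) ≤ ((t / c : ℝ) : ℂ) := by exact_mod_cast (by positivity)
  have hcC : (c : ℂ) ≠ 0 := by exact_mod_cast hc0.ne'
  set S := ((s / c : ℝ) : ℂ) • hsAdjoint T₀ + ((t / c : ℝ) : ℂ) • hsAdjoint T₁ with hS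
  refine ⟨S, (hT₀.hsAdjoint.smul hsc).add (hT₁.hsAdjoint.smul htc), ?_⟩
  refine twirl_eq_wernerMap hd (transposeMap dA ∘ₗ S ∘ₗ P) p ?_ ?_
  · rw [trace_transposeMap_comp]
    have : (S ∘ₗ P) 1 = ((s / c : ℝ) : ℂ) • (hsAdjoint T₀ ∘ₗ P) 1 +
      ((t / c : ℝ) : ℂ) • (hsAdjoint T₁ ∘ₗ P) 1 := rfl
    rw [this, Matrix.trace_add, Matrix.trace_smul, Matrix.trace_smul, eD₀, eD₁, smul_eq_mul,
      smul_eq_mul]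
    norm_cast
    rw [hc]
    field_simp
  · have : ∀ i k, coeff (transposeMap dA ∘ₗ S ∘ₗ P) i k k i =
        ((s / c : ℝ) : ℂ) * coeff (transposeMap dA ∘ₗ hsAdjoint T₀ ∘ₗ P) i k k i +
        ((t / c : ℝ) : ℂ) * coeff (transposeMap dA ∘ₗ hsAdjoint T₁ ∘ₗ P) i k k i :=
      fun i k => rfl
    simp only [this, Finset.sum_add_distrib, ← Finset.mul_sum]
    rw [sum_coeff_transposeMap_comp hT₀, sum_coeff_transposeMap_comp hT₁, eN₀, eN₁]
    norm_cast
    field_simp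
    rw [hc, hs, ht]
    ring
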